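/- Let $l,m\ge 0$ and $n_1,\dots,n_l\ge 0$ be integers. For $i=1,\dots,l$ let $X_i\subseteq\mathbb R^{n_i}$ be closed and convex, $X=X_1\times\dots\times X_l$, let $f_i:X\to\mathbb R$ be continuous on $X$ and concave in its $i$-th variable, and let $h_i=(h_{i1},\dots,h_{im}):\mathbb R^{n_i}\to\mathbb R^m$ have convex components. Let $b\in\mathbb R^m$ and suppose that $D=\{x\in X:\sum_{i=1}^l h_i(x_i)\le b\}$ is nonempty (inequalities between vectors are componentwise). Put $$\Phi(x,y)=\sum_{i=1}^l\bigl[f_i(x)-f_i(x_{-i},y_i)\bigr].$$ A normalized equilibrium is a point $x^*\in D$ with $$\Phi(x^*,y)\ge 0\quad\text{for all } y\in D. \tag{2.1}$$ Let $U_0\subseteq\mathbb R^{ml}$ be such that $U=\{u=(u_1,\dots,u_l)\in U_0:\sum_{i=1}^l u_i=b\}$ is closed and convex and for each $x\in D$ there is $u\in U$ with $h_i(x_i)\le u_i$ for all $i$. Let $\varphi:\mathbb R^m\to[0,\infty)$ be convex, differentiable and isotone ($u\ge v$ implies $\varphi(u)\ge\varphi(v)$), with $\varphi(v)=0$ if $v\le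 0$ and $\varphi(v)>0$ otherwise, and for $w=(x,u)$ put $P(w)=\sum_{i=1}^l\varphi(h_i(x_i)-u_i)$. For $\tau>0$ the penalized problem is to find $w(\tau)=(x(\tau),u(\tau))\in X\times U$ with $$\Phi(x(\tau),x)+\tau\,[P(w)-P(w(\tau))]\ge 0\quad\text{for all } w=(x,u)\in X\times U. \tag{3.1}$$ A real function is called weakly coercive with respect to a set if at least one of its level sets $\{\,\cdot\le\rho\}$, $\rho\in\mathbb R$, in that set is nonempty and bounded. Suppose that $\mu:X\to\mathbb R$ is lower semicontinuous, convex and weakly coercive with respect to $X$, and that $r\in\mathbb R$ is such that, with $B_r=\{x\in X:\mu(x)\le r\}$, for every $x\in X\setminus B_r$ there is $z\in D$ with $\mu(z)\le\mu(x)$ and $\Phi(x,z)<0$. Put $\eta(w)=\max\{\mu(x),P(w)\}$ for $w=(x,u)$ and $E_r=\{w\in X\times U:\eta(w)\le r\}$. Let $(\tau_k)$ be a sequence of positive numbers with $\tau_k\to+\infty$. Then: (i) problem (2.1) has a solution; (ii) $\eta$ is weakly coercive with respect to $X\times U$; there is $\tau'>0$ such that for every $\tau>\tau'$ problem (3.1)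 has a solution and, if $r>0$, all its solutions belong to $E_r$; (iii) every sequence $(w(\tau_k))$, where $w(\tau_k)$ solves (3.1) with $\tau=\tau_k$, has limit points; every limit point $(\bar x,\bar u)$ belongs to $(B_r\cap D)\times U$, and $\bar x$ solves (2.1). -/

import Mathlib

/-- The level set `{x ∈ S | η x ≤ r}`. -/
def levelSet {α : Type*} (S : Set α) (η : α → ℝ) (r : ℝ) : Set α :=
  {x | x ∈ S ∧ η x ≤ r}

/-- `η` is weakly coercive with respect to `S`: some level set of `η` on `S` is nonempty and
bounded. -/
def WeaklyCoerciveOn {α : Type*} [Bornology α] (S : Set α) (η : α → ℝ) : Prop :=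
  ∃ r : ℝ, (levelSet S η r).Nonempty ∧ Bornology.IsBounded (levelSet S η r)

/-- The data of a generalized `l`-person game with `m` joint constraints. Utilities are total
functions, but only their values on the product of the strategy sets are ever used. -/
structure JointGame (l m : ℕ) where
  /-- dimension of the strategy space of each player -/
  n : Fin l → ℕ
  /-- strategy sets -/
  strat : (i : Fin l) → Set (EuclideanSpace ℝ (Fin (n i)))
  /-- utility functions -/
  f : Fin l → ((i : Fin l) → EuclideanSpace ℝ (Fin (n i))) → ℝ
  /-- constraint functions -/
  h : (i : Fin l) → EuclideanSpace ℝ (Fin (n i)) → Fin m → ℝ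
  /-- right-hand side of the joint constraint -/
  b : Fin m → ℝ

namespace JointGame

variable {l m : ℕ} (G : JointGame l m)

/-- Joint strategies `x = (x_1, …, x_l)`. -/
abbrev Profile : Type := (i : Fin l) → EuclideanSpace ℝ (Fin (G.n i))

/-- `X = X_1 × ⋯ × X_l`. -/
def X : Set G.Profile := {x | ∀ i, x i ∈ G.strat i}

/-- The joint constraint set `Y`. -/
def Y : Set G.Profile := {x | ∑ i, G.h i (x i) ≤ G.b}

/-- The common feasible set `D = X ∩ Y`. -/
def D : Set G.Profile := G.X ∩ G.Y

/-- `Ψ(x, y) = ∑ i, f_i(x_{-i}, y_i)`. -/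
noncomputable def Psi (x y : G.Profile) : ℝ := ∑ i, G.f i (Function.update x i (y i))

/-- The Nikaido–Isoda bifunction `Φ(x, y) = Ψ(x, x) - Ψ(x, y)`. -/
noncomputable def Phi (x y : G.Profile) : ℝ := G.Psi x x - G.Psi x y

/-- The basic assumptions on the game. -/
structure BasicAssumptions : Prop where
  strat_convex : ∀ i, Convex ℝ (G.strat i)
  strat_closed : ∀ i, IsClosed (G.strat i)
  utility_concave : ∀ i, ∀ x ∈ G.X,
    ConcaveOn ℝ (G.strat i) (fun y => G.f i (Function.update x i y))
  utility_continuous : ∀ i, ContinuousOn (G.f i) G.X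
  constraint_convex : ∀ i j, ConvexOn ℝ Set.univ (fun y => G.h i y j)
  feasible_nonempty : G.D.Nonempty

/-- `x` is a normalized equilibrium point: `x ∈ D` and `Φ(x, y) ≥ 0` for all `y ∈ D`. -/
def IsNormalizedEquilibrium (x : G.Profile) : Prop :=
  x ∈ G.D ∧ ∀ y ∈ G.D, 0 ≤ G.Phi x y

/-- The coercivity condition on `μ : X → ℝ` and the number `r`. -/
structure Coercivity (μ : G.Profile → ℝ) (r : ℝ) : Prop where
  lsc : LowerSemicontinuousOn μ G.X
  convex : ConvexOn ℝ G.X μ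
  weaklyCoercive : WeaklyCoerciveOn G.X μ
  descent : ∀ x ∈ G.X \ levelSet G.X μ r, ∃ z ∈ G.D, μ z ≤ μ x ∧ G.Phi x z < 0

/-- The feasible partitions `u = (u_1, …, u_l)` of `b` that satisfy the additional
restrictions `U₀`. -/
def U (U₀ : Set (Fin l → Fin m → ℝ)) : Set (Fin l → Fin m → ℝ) :=
  {u | u ∈ U₀ ∧ ∑ i, u i = G.b}

/-- The requirements on the restriction set: `U` is closed and convex, and every jointly
feasible strategy is feasible for some partition in `U`. -/
structure AdmissibleRestriction (U₀ : Set (Fin l → Fin m → ℝ)) : Prop where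
  closed : IsClosed (G.U U₀)
  convex : Convex ℝ (G.U U₀)
  covers : ∀ x ∈ G.D, ∃ u ∈ G.U U₀, ∀ i, G.h i (x i) ≤ u i

/-- The penalty `P(x, u) = ∑ i, φ(h_i(x_i) - u_i)`. -/
noncomputable def P (φ : (Fin m → ℝ) → ℝ) (w : G.Profile × (Fin l → Fin m → ℝ)) : ℝ :=
  ∑ i, φ (G.h i (w.1 i) - w.2 i)

/-- `w = (x, u)` solves the penalized equilibrium problem on `X × U` with parameter `τ`. -/
def IsPenaltySolution (U₀ : Set (Fin l → Fin m → ℝ)) (φ : (Fin m → ℝ) → ℝ) (τ : ℝ)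
    (w : G.Profile × (Fin l → Fin m → ℝ)) : Prop :=
  w ∈ G.X ×ˢ G.U U₀ ∧
    ∀ w' ∈ G.X ×ˢ G.U U₀, 0 ≤ G.Phi w.1 w'.1 + τ * (G.P φ w' - G.P φ w)

/-- `η(x, u) = max {μ(x), P(x, u)}`. -/
noncomputable def eta (φ : (Fin m → ℝ) → ℝ) (μ : G.Profile → ℝ)
    (w : G.Profile × (Fin l → Fin m → ℝ)) : ℝ :=
  max (μ w.1) (G.P φ w)

end JointGame

/-- The requirements on the penalty generator `φ : ℝ^m → ℝ₊`; the order on `Fin m → ℝ` is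
the componentwise one. -/
structure IsPenaltyGenerator {m : ℕ} (φ : (Fin m → ℝ) → ℝ) : Prop where
  convex : ConvexOn ℝ Set.univ φ
  differentiable : Differentiable ℝ φ
  isotone : Monotone φ
  eq_zero : ∀ v, v ≤ 0 → φ v = 0
  pos : ∀ v, ¬ v ≤ 0 → 0 < φ v

open Finset Filter Topology

/-!
The existence part rests on Ky Fan's inequality, which is derived here from Scarf's combinatorial
lemma. Rank finitely many points in several ways, and call a dominant set with as many points as
there are rankings a room, and one with one point fewer a door. Each inner door belongs to exactly
two rooms and the outer door to one, so by parity some room carries all colours. Applied to the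
grid points of a simplex this gives a covering theorem, hence Ky Fan's inequality on compact convex
sets.

Coercivity replaces compactness. A convex function with one nonempty bounded level set has only
bounded ones, and a solution on a level set that lies strictly inside it is a solution everywhere,
by convexity along segments. The descent condition forces solutions into `B_r`. On the penalized
problem, testing with feasible points (where `P` vanishes) gives `τ P(w(τ)) ≤ Φ(x(τ), z)`, and the
right-hand side is bounded on `B_r`; so the penalty is at most `r` for large `τ`, and tends to `0`
as `τ → ∞`, which makes the limit points feasible.
-/

/-! ### Scarf's lemma -/

theorem exists_ne_image_erase_eq_iff {α β : Type*} [DecidableEq α] [DecidableEq β] {f : α → β}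
    {s : Finset α} {t : Finset β} (hst : s.image f = t) (hcard : #t + 1 = #s) :
    ∃ x ∈ s, ∃ y ∈ s, x ≠ y ∧ ∀ z ∈ s, (s.erase z).image f = t ↔ z = x ∨ z = y := by
  obtain ⟨x, hx, y, hy, hxy, hf⟩ := exists_ne_map_eq_of_card_lt_of_maps_to (by omega)
    fun a ha ↦ hst ▸ mem_image_of_mem f ha
  have image_erase : ∀ a ∈ s, ∀ b ∈ s, a ≠ b → f a = f b → (s.erase a).image f = t := by
    intro a ha b hb hab hfab
    rw [← hst, ← insert_erase ha, image_insert, erase_insert (notMem_erase a s), hfab,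
      insert_eq_self.2 (mem_image_of_mem f (mem_erase.2 ⟨hab.symm, hb⟩))]
  refine ⟨x, hx, y, hy, hxy, fun z hz ↦ ⟨fun himage ↦ ?_, ?_⟩⟩
  · by_contra! hne
    have hinj : Set.InjOn f (s.erase z) :=
      injOn_of_card_image_eq (by rw [himage, card_erase_of_mem hz]; omega)
    exact hxy (hinj (by simp [hx, hne.1.symm]) (by simp [hy, hne.2.symm]) hf)
  · rintro (rfl | rfl)
    exacts [image_erase _ hx _ hy hxy hf, image_erase _ hy _ hx hxy.symm hf.symm]

section Scarf

variable {I T α : Type*} [LinearOrder α] {rk : I → T → α} {A B : Finset T}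

/-- Dominance in the sense of Scarf: no point lies above the lowest point of `A` in every
ranking. -/
def IsDominant (rk : I → T → α) (A : Finset T) : Prop :=
  ∀ y, ∃ i, ∀ a ∈ A, rk i y ≤ rk i a

/-- `low i` is the lowest point of `B` in the ranking `i`; for a dominant `B` these are all the
points of `B`. -/
def IsLowest (rk : I → T → α) (B : Finset T) (low : I → T) : Prop :=
  ∀ i, low i ∈ B ∧ ∀ b ∈ B, rk i (low i) ≤ rk i b

/-- The points that lie above `low i` in every ranking `i ≠ j`, among which the point that completes
a door to a room is the highest in the ranking `j`. -/
def aboveExcept (rk : I → T → α) (low : I → T) (j : I) : Set T :=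
  {y | ∀ i ≠ j, rk i (low i) < rk i y}

theorem IsDominant.mono (hA : IsDominant rk A) (hBA : B ⊆ A) : IsDominant rk B := fun y ↦
  (hA y).imp fun _ hi b hb ↦ hi b (hBA hb)

theorem exists_isLowest (rk : I → T → α) (hB : B.Nonempty) : ∃ low, IsLowest rk B low :=
  Classical.axiom_of_choice fun i ↦ exists_min_image B (rk i) hB

theorem notMem_of_mem_aboveExcept [Fintype I] [DecidableEq I] [DecidableEq T] {low : I → T} {j : I}
    {a : T} (hj : (univ.erase j).image low = B) (ha : a ∈ aboveExcept rk low j) : a ∉ B := by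
  rw [← hj]
  rintro haB
  obtain ⟨i, hi, rfl⟩ := mem_image.1 haB
  exact (ha i (mem_erase.1 hi).1).false

namespace IsLowest

variable {low : I → T} (hlow : IsLowest rk B low)
include hlow

theorem exists_le (hB : IsDominant rk B) (y : T) : ∃ i, rk i y ≤ rk i (low i) :=
  (hB y).imp fun i hi ↦ hi _ (hlow i).1

theorem image_eq [Fintype I] [DecidableEq T] (hrk : ∀ i, Function.Injective (rk i))
    (hB : IsDominant rk B) : univ.image low = B := by
  refine (image_subset_iff.2 fun i _ ↦ (hlow i).1).antisymm fun b hb ↦ ?_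
  obtain ⟨i, hi⟩ := hB b
  exact mem_image.2 ⟨i, mem_univ i, hrk i (((hlow i).2 b hb).antisymm (hi _ (hlow i).1))⟩

theorem isDominant_insert [DecidableEq T] (hB : IsDominant rk B) {j : I} {a : T}
    (ha : a ∈ aboveExcept rk low j) (hmax : IsMaxOn (rk j) (aboveExcept rk low j) a) :
    IsDominant rk (insert a B) := by
  intro y
  simp only [forall_mem_insert]
  by_cases hy : y ∈ aboveExcept rk low j
  · have haj : rk j a ≤ rk j (low j) := by
      obtain ⟨i, hi⟩ := hlow.exists_le hB a
      obtain rfl : i = j := by_contra fun hij ↦ (ha i hij).not_ge hi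
      exact hi
    have hya : rk j y ≤ rk j a := hmax hy
    exact ⟨j, hya, fun b hb ↦ hya.trans (haj.trans ((hlow j).2 b hb))⟩
  · obtain ⟨i, hij, hi⟩ : ∃ i ≠ j, rk i y ≤ rk i (low i) := by
      simpa [aboveExcept] using hy
    exact ⟨i, hi.trans (ha i hij).le, fun b hb ↦ hi.trans ((hlow i).2 b hb)⟩

theorem exists_isMaxOn_of_isDominant_insert [Fintype I] [DecidableEq I] [DecidableEq T]
    (hrk : ∀ i, Function.Injective (rk i)) (hcard : #B + 1 = Fintype.card I) {a : T} (ha : a ∉ B)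
    (hdom : IsDominant rk (insert a B)) :
    ∃ j, (univ.erase j).image low = B ∧ a ∈ aboveExcept rk low j ∧
      IsMaxOn (rk j) (aboveExcept rk low j) a := by
  obtain ⟨low', hlow'⟩ := exists_isLowest rk (insert_nonempty a B)
  have himage : univ.image low' = insert a B := hlow'.image_eq hrk hdom
  have hinj : Function.Injective low' := by
    rw [← Set.injOn_univ, ← coe_univ]
    exact injOn_of_card_image_eq (by rw [himage, card_insert_of_notMem ha, hcard, card_univ])
  obtain ⟨j, -, rfl⟩ := mem_image.1 (himage ▸ mem_insert_self a B)
  have mem_B {i : I} (hij : i ≠ j) : low' i ∈ B :=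
    mem_of_mem_insert_of_ne (hlow' i).1 (hinj.ne hij)
  have low'_eq {i : I} (hij : i ≠ j) : low' i = low i :=
    hrk i (((hlow' i).2 _ (mem_insert_of_mem (hlow i).1)).antisymm ((hlow i).2 _ (mem_B hij)))
  have hmem : low' j ∈ aboveExcept rk low j := fun i hij ↦
    low'_eq hij ▸ ((hlow' i).2 _ (mem_insert_self _ B)).lt_of_ne ((hrk i).ne (hinj.ne hij))
  refine ⟨j, ?_, hmem, fun y hy ↦ ?_⟩
  · rw [← image_congr fun i hi ↦ low'_eq (mem_erase.1 hi).1, image_erase hinj, himage,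
      erase_insert ha]
  · obtain ⟨i, hi⟩ := hdom y
    obtain rfl : i = j :=
      by_contra fun hij ↦ (hy i hij).not_ge (hi _ (mem_insert_of_mem (hlow i).1))
    exact hi _ (mem_insert_self _ B)

end IsLowest

/-- The hypothesis `hup` says that the door `B` is an inner one. -/
theorem exists_ne_forall_covBy_isDominant_iff [Finite T] [Fintype I]
    (hrk : ∀ i, Function.Injective (rk i)) (hB : IsDominant rk B) (hne : B.Nonempty)
    (hcard : #B + 1 = Fintype.card I) (hup : ∀ j, ∃ y, ∀ i ≠ j, ∃ b ∈ B, rk i b < rk i y) :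
    ∃ A₀ A₁, A₀ ≠ A₁ ∧ ∀ A, B ⋖ A ∧ IsDominant rk A ↔ A = A₀ ∨ A = A₁ := by
  classical
  obtain ⟨low, hlow⟩ := exists_isLowest rk hne
  obtain ⟨j₀, -, j₁, -, hj, hpair⟩ :=
    exists_ne_image_erase_eq_iff (hlow.image_eq hrk hB) (by rwa [card_univ])
  have exists_max (j : I) :
      ∃ a ∈ aboveExcept rk low j, IsMaxOn (rk j) (aboveExcept rk low j) a := by
    refine Set.exists_max_image _ _ (Set.toFinite _) ?_
    obtain ⟨y, hy⟩ := hup j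
    refine ⟨y, fun i hij ↦ ?_⟩
    obtain ⟨b, hb, hby⟩ := hy i hij
    exact ((hlow i).2 b hb).trans_lt hby
  choose top htop hmax using exists_max
  have top_notMem {j : I} (hj : j = j₀ ∨ j = j₁) : top j ∉ B :=
    notMem_of_mem_aboveExcept ((hpair j (mem_univ j)).2 hj) (htop j)
  have top_ne : top j₀ ≠ top j₁ := by
    intro heq
    obtain ⟨i, hi⟩ := hlow.exists_le hB (top j₀)
    obtain rfl : i = j₀ := by_contra fun hij ↦ (htop j₀ i hij).not_ge hi
    exact (htop j₁ i hj).not_ge (heq ▸ hi)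
  have room {j : I} (hj : j = j₀ ∨ j = j₁) :
      B ⋖ insert (top j) B ∧ IsDominant rk (insert (top j) B) :=
    ⟨covBy_insert (top_notMem hj), hlow.isDominant_insert hB (htop j) (hmax j)⟩
  refine ⟨insert (top j₀) B, insert (top j₁) B, fun heq ↦ top_ne ?_, fun A ↦ ⟨?_, ?_⟩⟩
  · exact (mem_insert.1 (heq ▸ mem_insert_self (top j₀) B)).resolve_right (top_notMem (.inl rfl))
  · rintro ⟨hBA, hA⟩
    obtain ⟨a, ha, rfl⟩ := covBy_iff_exists_insert.1 hBA
    obtain ⟨j, hj, hja, hjmax⟩ := hlow.exists_isMaxOn_of_isDominant_insert hrk hcard ha hA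
    obtain rfl : a = top j := hrk j ((hmax j hja).antisymm (hjmax (htop j)))
    exact ((hpair j (mem_univ j)).1 hj).imp (congrArg fun k ↦ insert (top k) B)
      (congrArg fun k ↦ insert (top k) B)
  · rintro (rfl | rfl)
    exacts [room (.inl rfl), room (.inr rfl)]

/-- The points `d i` close off the simplex of the other points: `d i` is the lowest point in its own
ranking, and lies above all points that are not of this form in every other ranking. -/
structure IsSlack (rk : I → T → α) (d : I → T) : Prop where
  le : ∀ i y, rk i (d i) ≤ rk i y
  lt : ∀ ⦃i j⦄, i ≠ j → ∀ y ∉ Set.range d, rk i y < rk i (d j)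

theorem IsSlack.exists_forall_covBy_isDominant_iff [Finite T] [Fintype I] [DecidableEq I]
    [DecidableEq T] (hrk : ∀ i, Function.Injective (rk i)) {d : I → T} (hd : IsSlack rk d)
    (hne : (Set.range d)ᶜ.Nonempty) (k : I) :
    ∃ A₀, ∀ A, (univ.erase k).image d ⋖ A ∧ IsDominant rk A ↔ A = A₀ := by
  set B := (univ.erase k).image d
  have hBd : ∀ b ∈ B, ∃ i ≠ k, d i = b := fun b hb ↦ by simpa [B] using hb
  have mem_B {i : I} (hi : i ≠ k) : d i ∈ B := mem_image_of_mem d (by simpa using hi)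
  obtain ⟨a₀, ha₀, hmax⟩ := Set.exists_max_image _ (rk k) (Set.toFinite (Set.range d)ᶜ) hne
  have a₀_notMem : a₀ ∉ B := fun h ↦ by
    obtain ⟨i, -, hi⟩ := hBd a₀ h
    exact ha₀ ⟨i, hi⟩
  refine ⟨insert a₀ B, fun A ↦ ⟨?_, ?_⟩⟩
  · rintro ⟨hBA, hA⟩
    obtain ⟨a, ha, rfl⟩ := covBy_iff_exists_insert.1 hBA
    have le_a : ∀ y ∉ Set.range d, rk k y ≤ rk k a := by
      intro y hy
      obtain ⟨i, hi⟩ := hA y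
      obtain rfl : i = k := by
        by_contra hik
        have hyi := (hd.le i y).antisymm (hi _ (mem_insert_of_mem (mem_B hik)))
        exact hy ⟨i, hrk i hyi⟩
      exact hi a (mem_insert_self a B)
    have ha_range : a ∉ Set.range d := by
      rintro ⟨i, rfl⟩
      obtain rfl : i = k := by_contra fun hik ↦ ha (mem_B hik)
      exact ha₀ ⟨i, hrk i ((hd.le i a₀).antisymm (le_a a₀ ha₀))⟩
    rw [hrk k ((hmax a ha_range).antisymm (le_a a₀ ha₀))]
  · rintro rfl
    refine ⟨covBy_insert a₀_notMem, fun y ↦ ?_⟩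
    by_cases hy : y ∈ Set.range d
    · obtain ⟨i, rfl⟩ := hy
      exact ⟨i, fun a _ ↦ hd.le i a⟩
    · refine ⟨k, (forall_mem_insert _ _ _).2 ⟨hmax y hy, fun b hb ↦ ?_⟩⟩
      obtain ⟨i, hik, rfl⟩ := hBd b hb
      exact (hd.lt hik.symm y hy).le

open Classical in
theorem even_card_covBy_image_eq_erase [Fintype T] [Fintype I] [DecidableEq I]
    {c : T → I} (hcard : #A = Fintype.card I) (hc : A.image c ≠ univ) (k : I) :
    Even #{B : Finset T | B ⋖ A ∧ B.image c = univ.erase k} := by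
  rcases eq_empty_or_nonempty ({B | B ⋖ A ∧ B.image c = univ.erase k} : Finset (Finset T))
    with h | ⟨B, hB⟩
  · simp [h]
  obtain ⟨hBA, hBc⟩ : B ⋖ A ∧ B.image c = univ.erase k := by simpa using hB
  have hAc : A.image c = univ.erase k := by
    refine ((hBc ▸ image_subset_image hBA.le).antisymm fun i hi ↦ ?_).symm
    refine mem_erase.2 ⟨?_, mem_univ i⟩
    rintro rfl
    exact hc (eq_univ_of_forall fun j ↦ (eq_or_ne j i).elim (fun h ↦ h ▸ hi) fun h ↦
      image_subset_image hBA.le (hBc ▸ mem_erase.2 ⟨h, mem_univ j⟩))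
  obtain ⟨x, hx, y, hy, hxy, hpair⟩ := exists_ne_image_erase_eq_iff hAc
    (by rw [card_erase_of_mem (mem_univ k), card_univ, hcard]
        exact Nat.succ_pred_eq_of_pos (Fintype.card_pos_iff.2 ⟨k⟩))
  have hdoors : ({B : Finset T | B ⋖ A ∧ B.image c = univ.erase k} : Finset _) =
      {A.erase x, A.erase y} := by
    ext B
    simp only [mem_filter_univ, mem_insert, mem_singleton]
    constructor
    · rintro ⟨hBA, hBc⟩
      obtain ⟨z, hz, rfl⟩ := covBy_iff_exists_erase.1 hBA
      exact ((hpair z hz).1 hBc).imp (congrArg A.erase) (congrArg A.erase)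
    · rintro (rfl | rfl)
      exacts [⟨erase_covBy hx, (hpair x hx).2 (.inl rfl)⟩,
        ⟨erase_covBy hy, (hpair y hy).2 (.inr rfl)⟩]
  rw [hdoors, card_pair fun h ↦ hxy (erase_injOn A hx hy h)]
  exact even_two

theorem exists_mem_notMem_range [Fintype I] [DecidableEq I] [DecidableEq T] {d : I → T} {c : T → I}
    (hcd : ∀ i, c (d i) = i) {k : I} (hcard : #B + 1 = Fintype.card I)
    (hBc : B.image c = univ.erase k) (hB : B ≠ (univ.erase k).image d) :
    ∃ b ∈ B, b ∉ Set.range d := by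
  by_contra! h
  have hBd : B ⊆ (univ.erase k).image d := by
    intro b hb
    obtain ⟨i, rfl⟩ := h b hb
    exact mem_image_of_mem d (hBc ▸ hcd i ▸ mem_image_of_mem c hb)
  refine hB (eq_of_subset_of_card_le hBd ?_)
  have := card_image_le (s := univ.erase k) (f := d)
  rw [card_erase_of_mem (mem_univ k), card_univ] at this
  omega

open Classical in
theorem IsSlack.odd_card_covBy_isDominant_iff [Fintype T] [Fintype I]
    [DecidableEq I] (hrk : ∀ i, Function.Injective (rk i)) {d : I → T} (hd : IsSlack rk d)
    (hne : (Set.range d)ᶜ.Nonempty) {c : T → I} (hcd : ∀ i, c (d i) = i) {k : I}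
    (hcard : #B + 1 = Fintype.card I) (hB : IsDominant rk B) (hBc : B.image c = univ.erase k) :
    Odd #{A : Finset T | B ⋖ A ∧ IsDominant rk A} ↔ B = (univ.erase k).image d := by
  refine ⟨fun hodd ↦ ?_, ?_⟩
  · by_contra hBd
    obtain ⟨b, hb, hbd⟩ := exists_mem_notMem_range hcd hcard hBc hBd
    obtain ⟨A₀, A₁, hA, hpair⟩ := exists_ne_forall_covBy_isDominant_iff hrk hB ⟨b, hb⟩ hcard
      fun j ↦ ⟨d j, fun i hij ↦ ⟨b, hb, hd.lt hij b hbd⟩⟩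
    have : ({A | B ⋖ A ∧ IsDominant rk A} : Finset (Finset T)) = {A₀, A₁} := by ext A; simp [hpair]
    rw [this, card_pair hA] at hodd
    exact absurd even_two (Nat.not_even_iff_odd.2 hodd)
  · rintro rfl
    obtain ⟨A₀, hA₀⟩ := hd.exists_forall_covBy_isDominant_iff hrk hne k
    have : ({A | (univ.erase k).image d ⋖ A ∧ IsDominant rk A} : Finset (Finset T)) = {A₀} := by
      ext A
      rw [mem_filter_univ, hA₀, mem_singleton]
    rw [this, card_singleton]
    exact odd_one

/-- **Scarf's lemma.** Among the doors that miss exactly the colour `k`, only the outer one lies on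
an odd number of rooms, so some room has an odd number of such doors. -/
theorem IsSlack.exists_isDominant_image_eq_univ [Finite T] [Fintype I] [Nonempty I]
    [DecidableEq I] (hrk : ∀ i, Function.Injective (rk i)) {d : I → T} (hd : IsSlack rk d)
    (hne : (Set.range d)ᶜ.Nonempty) {c : T → I} (hcd : ∀ i, c (d i) = i) :
    ∃ A, #A = Fintype.card I ∧ IsDominant rk A ∧ A.image c = univ := by
  classical
  have := Fintype.ofFinite T
  by_contra! hno
  obtain ⟨k⟩ := ‹Nonempty I›
  let rooms : Finset (Finset T) := {A | #A = Fintype.card I ∧ IsDominant rk A}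
  let doors : Finset (Finset T) :=
    {B | #B + 1 = Fintype.card I ∧ IsDominant rk B ∧ B.image c = univ.erase k}
  let B₀ : Finset T := (univ.erase k).image d
  have outer_mem : B₀ ∈ doors := by
    obtain ⟨A₀, hA₀⟩ := hd.exists_forall_covBy_isDominant_iff hrk hne k
    obtain ⟨hBA, hA⟩ := (hA₀ A₀).2 rfl
    refine mem_filter_univ _ |>.2 ⟨?_, hA.mono hBA.le,
      by simp [B₀, image_image, Function.comp_def, hcd]⟩
    rw [card_image_of_injective _ (Function.LeftInverse.injective hcd),
      card_erase_add_one (mem_univ k), card_univ]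
  have odd_rooms_iff : ∀ B ∈ doors, Odd #{A ∈ rooms | B ⋖ A} ↔ B = B₀ := by
    intro B hB
    obtain ⟨hBcard, hBdom, hBc⟩ := mem_filter_univ _ |>.1 hB
    convert hd.odd_card_covBy_isDominant_iff hrk hne hcd hBcard hBdom hBc using 3
    ext A
    have (h : B ⋖ A) : #A = Fintype.card I := by rw [← hBcard]; exact h.card_finset.succ_eq.symm
    simp only [rooms, mem_filter, mem_univ, true_and]
    tauto
  have even_doors : ∀ A ∈ rooms, Even #{B ∈ doors | B ⋖ A} := by
    intro A hA
    obtain ⟨hAcard, hAdom⟩ := mem_filter_univ _ |>.1 hA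
    convert even_card_covBy_image_eq_erase hAcard (hno A hAcard hAdom) k using 2
    ext B
    have (h : B ⋖ A) : #B + 1 = Fintype.card I := by rw [← hAcard]; exact h.card_finset.succ_eq
    have (h : B ⋖ A) : IsDominant rk B := hAdom.mono h.le
    simp only [doors, mem_filter, mem_univ, true_and]
    tauto
  have hcount : ∑ B ∈ doors, #{A ∈ rooms | B ⋖ A} = ∑ A ∈ rooms, #{B ∈ doors | B ⋖ A} :=
    sum_card_bipartiteAbove_eq_sum_card_bipartiteBelow (· ⋖ ·)
  have hodd : Odd (∑ B ∈ doors, #{A ∈ rooms | B ⋖ A}) := by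
    rw [odd_sum_iff_odd_card_odd, filter_congr odd_rooms_iff, filter_eq', if_pos outer_mem,
      card_singleton]
    exact odd_one
  exact Nat.not_even_iff_odd.2 hodd (hcount ▸ even_sum _ even_doors)

end Scarf

section Rainbow

variable {I T α : Type*} [Finite I] [Finite T] [Nonempty T] [LinearOrder α]

open Classical in
/-- Scarf's lemma with one slack point adjoined for each colour; the colours outside `C` are those
whose slack point is used. -/
theorem exists_forall_exists_forall_le (rk : I → T → α) (c : T → I) :
    ∃ (C : Finset I) (p : I → T), (∀ i ∈ C, c (p i) = i) ∧
      ∀ y, ∃ i ∈ C, ∀ j ∈ C, rk i y ≤ rk i (p j) := by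
  have := Fintype.ofFinite I
  obtain ⟨t₀⟩ := ‹Nonempty T›
  have : Nonempty I := ⟨c t₀⟩
  obtain ⟨n, ⟨e⟩⟩ := Finite.exists_equiv_fin (T ⊕ I)
  let value (i : I) : T ⊕ I → WithBot (WithTop α) :=
    Sum.elim (fun t ↦ ↑(rk i t : WithTop α)) fun j ↦ if i = j then ⊥ else (⊤ : WithTop α)
  -- The rankings `value i` become injective by breaking ties with an enumeration of the points.
  let rk' (i : I) (t : T ⊕ I) : WithBot (WithTop α) ×ₗ Fin n := toLex (value i t, e t)
  have hrk' (i : I) : Function.Injective (rk' i) := fun s t h ↦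
    e.injective (congrArg (fun z ↦ (ofLex z).2) h)
  have value_le {i : I} {s t : T ⊕ I} (h : rk' i s ≤ rk' i t) : value i s ≤ value i t :=
    Prod.Lex.monotone_fst_ofLex h
  have hslack : IsSlack rk' Sum.inr := by
    refine ⟨fun i y ↦ ?_, fun i j hij y hy ↦ ?_⟩
    · obtain rfl | hy := eq_or_ne y (.inr i)
      · rfl
      · refine (Prod.Lex.toLex_lt_toLex.2 (.inl ?_)).le
        obtain t | j := y
        · simp [value]
        · have hij : i ≠ j := fun h ↦ hy (h ▸ rfl)
          simp [value, hij, bot_lt_iff_ne_bot]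
    · obtain t | k := y
      · refine Prod.Lex.toLex_lt_toLex.2 (.inl ?_)
        simpa [value, hij] using WithBot.coe_lt_coe.2 (WithTop.coe_lt_top (rk i t))
      · exact absurd ⟨k, rfl⟩ hy
  obtain ⟨A, -, hdom, hA⟩ := hslack.exists_isDominant_image_eq_univ hrk' ⟨.inl t₀, by simp⟩
    (c := Sum.elim c id) fun _ ↦ rfl
  have exists_point (i : I) : ∃ t, Sum.inr i ∉ A → Sum.inl t ∈ A ∧ c t = i := by
    obtain ⟨t | j, ht, hti⟩ := mem_image.1 (hA ▸ mem_univ i)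
    · exact ⟨t, fun _ ↦ ⟨ht, hti⟩⟩
    · exact ⟨t₀, fun hi ↦ absurd ((show j = i from hti) ▸ ht) hi⟩
  choose p hp using exists_point
  refine ⟨({i | .inr i ∉ A} : Finset I), p, fun i hi ↦ (hp i (by simpa using hi)).2, fun y ↦ ?_⟩
  obtain ⟨i, hi⟩ := hdom (.inl y)
  refine ⟨i, mem_filter_univ _ |>.2 fun hiA ↦ ?_, fun j hj ↦ ?_⟩
  · simpa [value] using value_le (hi _ hiA)
  · simpa [value] using value_le (hi _ (hp j (by simpa using hj)).1)

end Rainbow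

/-! ### Ky Fan's inequality -/

section Cover

variable {I : Type*} [Fintype I]

theorem lt_sum_inf'_add_one {C : Finset I} (hC : C.Nonempty) {p : I → I → ℕ} {N : ℕ}
    (hp : ∀ y : I → ℕ, ∑ k, y k = N → ∃ i ∈ C, ∀ j ∈ C, y i ≤ p j i) :
    N < ∑ k ∈ C, (C.inf' hC (p · k) + 1) := by
  classical
  by_contra! hle
  obtain ⟨k₀, -⟩ := id hC
  let y (k : I) : ℕ := (if k ∈ C then C.inf' hC (p · k) + 1 else 0) +
    if k = k₀ then N - ∑ k ∈ C, (C.inf' hC (p · k) + 1) else 0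
  obtain ⟨i, hi, hle⟩ := hp y (by
    rw [sum_add_distrib, sum_ite_mem, univ_inter, sum_ite_eq' univ, if_pos (mem_univ k₀)]
    exact Nat.add_sub_cancel' hle)
  have := le_inf' hC _ hle
  simp only [y, if_pos hi] at this
  omega

theorem le_add_card_of_sum_le {s : Finset I} {p q : I → ℕ} (hqp : q ≤ p)
    (hsum : ∑ k, p k ≤ ∑ k, q k + #s) (k : I) : p k ≤ q k + Fintype.card I := by
  have hk : p k - q k ≤ ∑ k, (p k - q k) :=
    single_le_sum (f := fun k ↦ p k - q k) (fun _ _ ↦ Nat.zero_le _) (mem_univ k)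
  have hadd : ∑ k, (p k - q k) + ∑ k, q k = ∑ k, p k := by
    rw [← sum_add_distrib]
    exact sum_congr rfl fun k _ ↦ Nat.sub_add_cancel (hqp k)
  have := card_le_univ s
  omega

theorem exists_rainbow_gridPoints [Nonempty I] (N : ℕ) (col : (I → ℕ) → I) :
    ∃ (C : Finset I) (p : I → I → ℕ), C.Nonempty ∧ (∀ i ∈ C, ∑ k, p i k = N ∧ col (p i) = i) ∧
      (∀ i ∈ C, ∀ k ∉ C, p i k ≤ Fintype.card I) ∧
      ∀ i ∈ C, ∀ j ∈ C, ∀ k, p i k ≤ p j k + Fintype.card I := by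
  classical
  let grid : Finset (I → ℕ) := piAntidiag univ N
  have mem_grid {a : I → ℕ} : a ∈ grid ↔ ∑ k, a k = N := by simp [grid]
  have : Nonempty grid :=
    ⟨⟨Pi.single (Classical.arbitrary I) N, mem_grid.2 (sum_pi_single' _ _ _ |>.trans (by simp))⟩⟩
  obtain ⟨C, p, hcol, hdom⟩ :=
    exists_forall_exists_forall_le (fun i (a : grid) ↦ a.1 i) fun a ↦ col a
  have hC : C.Nonempty := (hdom (Classical.arbitrary grid)).imp fun i hi ↦ hi.1
  have hsum (i : I) : ∑ k, (p i).1 k = N := mem_grid.1 (p i).2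
  let q (k : I) : ℕ := if k ∈ C then C.inf' hC fun j ↦ (p j).1 k else 0
  have hq : N < ∑ k, q k + #C := by
    have := lt_sum_inf'_add_one hC (p := fun j ↦ (p j).1) fun y hy ↦ hdom ⟨y, mem_grid.2 hy⟩
    simpa [q, sum_add_distrib, ← sum_filter] using this
  have q_le : ∀ i ∈ C, q ≤ (p i).1 := by
    intro i hi k
    by_cases hk : k ∈ C
    · exact (if_pos hk).trans_le (inf'_le (fun j ↦ (p j).1 k) hi)
    · exact (if_neg hk).trans_le (Nat.zero_le _)
  have le_q : ∀ i ∈ C, ∀ k, (p i).1 k ≤ q k + Fintype.card I := fun i hi ↦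
    le_add_card_of_sum_le (q_le i hi) ((hsum i).trans_le hq.le)
  refine ⟨C, fun i ↦ (p i).1, hC, fun i hi ↦ ⟨hsum i, hcol i hi⟩, fun i hi k hk ↦ ?_,
    fun i hi j hj k ↦ (le_q i hi k).trans (add_le_add_left (q_le j hj k) _)⟩
  simpa [q, hk] using le_q i hi k

theorem exists_forall_le_or_exists_dist_le {A : I → Set (I → ℝ)} [Nonempty I]
    (hcover : stdSimplex ℝ I ⊆ ⋃ i, A i) {ε : ℝ} (hε : 0 < ε) :
    ∃ x ∈ stdSimplex ℝ I, ∀ i, x i ≤ ε ∨ ∃ y ∈ A i, dist x y ≤ ε := by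
  obtain ⟨n, hn⟩ := exists_nat_gt (Fintype.card I / ε)
  have hn0 : (0 : ℝ) < n := (by positivity : (0 : ℝ) ≤ Fintype.card I / ε).trans_lt hn
  have hmesh : (Fintype.card I : ℝ) / n ≤ ε := ((div_lt_comm₀ hε hn0).1 hn).le
  let pt (a : I → ℕ) (k : I) : ℝ := a k / n
  have pt_mem {a : I → ℕ} (ha : ∑ k, a k = n) : pt a ∈ stdSimplex ℝ I :=
    ⟨fun k ↦ by positivity, by rw [← sum_div, ← Nat.cast_sum, ha, div_self hn0.ne']⟩
  have exists_color (a : I → ℕ) : ∃ i, ∑ k, a k = n → pt a ∈ A i := by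
    by_cases ha : ∑ k, a k = n
    · exact (Set.mem_iUnion.1 (hcover (pt_mem ha))).imp fun i hi _ ↦ hi
    · exact ⟨Classical.arbitrary I, fun h ↦ absurd h ha⟩
  choose col hcol using exists_color
  obtain ⟨C, p, ⟨i₀, hi₀⟩, hp, hsmall, hnear⟩ := exists_rainbow_gridPoints n col
  have sub_le {i j : I} (hi : i ∈ C) (hj : j ∈ C) (k : I) : pt (p i) k - pt (p j) k ≤ ε := by
    refine le_trans ?_ hmesh
    rw [← sub_div]
    gcongr
    exact sub_le_iff_le_add'.2 (by exact_mod_cast hnear i hi j hj k)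
  refine ⟨pt (p i₀), pt_mem (hp i₀ hi₀).1, fun i ↦ ?_⟩
  by_cases hi : i ∈ C
  · obtain ⟨hsum, hcoli⟩ := hp i hi
    refine .inr ⟨pt (p i), by simpa only [hcoli] using hcol (p i) hsum, ?_⟩
    exact (dist_pi_le_iff hε.le).2 fun k ↦ abs_sub_le_iff.2 ⟨sub_le hi₀ hi k, sub_le hi hi₀ k⟩
  · refine .inl (le_trans ?_ hmesh)
    simp only [pt]
    gcongr
    exact hsmall i₀ hi₀ i hi

/-- A form of the Knaster–Kuratowski–Mazurkiewicz covering theorem. -/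
theorem exists_forall_mem_of_isClosed_cover [Nonempty I] {A : I → Set (I → ℝ)}
    (hA : ∀ i, IsClosed (A i)) (hcover : stdSimplex ℝ I ⊆ ⋃ i, A i) :
    ∃ x ∈ stdSimplex ℝ I, ∀ i, x i ≠ 0 → x ∈ A i := by
  have exists_approx (n : ℕ) := exists_forall_le_or_exists_dist_le hcover
    (Nat.one_div_pos_of_nat (α := ℝ) (n := n))
  choose x hx hxA using exists_approx
  obtain ⟨a, ha, θ, hθ, hlim⟩ := (isCompact_stdSimplex ℝ I).tendsto_subseq hx
  have hε : Tendsto (fun n ↦ 1 / ((θ n : ℝ) + 1)) atTop (𝓝 0) :=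
    tendsto_one_div_add_atTop_nhds_zero_nat.comp hθ.tendsto_atTop
  refine ⟨a, ha, fun i hi ↦ ?_⟩
  have hsupp : ∀ᶠ n in atTop, 1 / ((θ n : ℝ) + 1) < x (θ n) i :=
    hε.eventually_lt (tendsto_pi_nhds.1 hlim i) ((ha.1 i).lt_of_ne' hi)
  have hdist : Tendsto (fun n ↦ dist a (x (θ n)) + 1 / ((θ n : ℝ) + 1)) atTop (𝓝 0) := by
    simpa using ((tendsto_const_nhds (x := a)).dist hlim).add hε
  rw [← (hA i).closure_eq, Metric.mem_closure_iff]
  intro δ hδ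
  obtain ⟨n, hn, hnδ⟩ := (hsupp.and (hdist.eventually_lt_const hδ)).exists
  obtain ⟨y, hy, hxy⟩ := (hxA (θ n) i).resolve_left hn.not_ge
  exact ⟨y, hy, (dist_triangle a _ y).trans_lt ((add_le_add_right hxy _).trans_lt hnδ)⟩

end Cover

theorem exists_mem_stdSimplex_forall_ne_zero_pos {I : Type*} [Fintype I] [Nonempty I]
    {g : I → (I → ℝ) → ℝ} (hg : ∀ i, ContinuousOn (g i) (stdSimplex ℝ I))
    (hg₀ : ∀ i, ∀ c ∈ stdSimplex ℝ I, 0 ≤ g i c) :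
    ∃ c ∈ stdSimplex ℝ I, (∀ i, g i c = 0) ∨ ∀ i, c i ≠ 0 → 0 < g i c := by
  have hclosed (i : I) : IsClosed {c | c ∈ stdSimplex ℝ I ∧ c i * ∑ j, g j c ≤ g i c} :=
    (isClosed_stdSimplex ℝ I).isClosed_le
      ((continuous_apply i).continuousOn.mul (continuousOn_finsetSum _ fun j _ ↦ hg j)) (hg i)
  obtain ⟨c, hc, hcg⟩ := exists_forall_mem_of_isClosed_cover hclosed <| by
    intro c hc
    obtain ⟨i, -, hi⟩ := exists_le_of_sum_le (s := univ) univ_nonempty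
      (f := fun i ↦ c i * ∑ j, g j c) (g := fun i ↦ g i c) (by rw [← sum_mul, hc.2, one_mul])
    exact Set.mem_iUnion.2 ⟨i, hc, hi⟩
  refine ⟨c, hc, or_iff_not_imp_left.2 fun hne i hi ↦ ?_⟩
  obtain ⟨j, hj⟩ := not_forall.1 hne
  have hsum : 0 < ∑ j, g j c :=
    sum_pos' (fun j _ ↦ hg₀ j c hc) ⟨j, mem_univ j, (hg₀ j c hc).lt_of_ne' hj⟩
  exact (mul_pos ((hc.1 i).lt_of_ne' hi) hsum).trans_le (hcg i hi).2

section KyFan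

variable {E : Type*} [AddCommGroup E] [Module ℝ E] [TopologicalSpace E] {K : Set E}
  {F : E → E → ℝ}

theorem exists_forall_mem_finset_nonneg [ContinuousAdd E] [ContinuousSMul ℝ E]
    (hK : Convex ℝ K) (hcont : ∀ y ∈ K, ContinuousOn (F · y) K)
    (hconv : ∀ x ∈ K, ConvexOn ℝ K (F x)) (hdiag : ∀ x ∈ K, 0 ≤ F x x) {u : Finset E}
    (hu : u.Nonempty) (huK : ↑u ⊆ K) : ∃ x ∈ K, ∀ y ∈ u, 0 ≤ F x y := by
  have := hu.to_subtype
  let pt (c : u → ℝ) : E := ∑ j, c j • (j : E)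
  have pt_mem : Set.MapsTo pt (stdSimplex ℝ u) K := fun c hc ↦
    hK.sum_mem (fun j _ ↦ hc.1 j) hc.2 fun j _ ↦ huK j.2
  have pt_cont : Continuous pt := by fun_prop
  obtain ⟨c, hc, hzero | hpos⟩ := exists_mem_stdSimplex_forall_ne_zero_pos
    (g := fun (j : u) c ↦ max 0 (-F (pt c) j))
    (fun j ↦ continuousOn_const.sup ((hcont j (huK j.2)).comp pt_cont.continuousOn pt_mem).neg)
    (fun _ _ _ ↦ le_max_left _ _)
  · exact ⟨pt c, pt_mem hc, fun y hy ↦ by simpa using hzero ⟨y, hy⟩⟩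
  · have hneg : pt c ∈ {y ∈ K | F (pt c) y < 0} := by
      have := ((hconv _ (pt_mem hc)).convex_lt 0).finsum_mem (z := fun j : u ↦ (j : E)) hc.1
        (by rw [finsum_eq_sum_of_fintype, hc.2])
        fun j hj ↦ ⟨huK j.2, by simpa using hpos j hj⟩
      rwa [finsum_eq_sum_of_fintype] at this
    exact absurd hneg.2 (hdiag _ (pt_mem hc)).not_gt

/-- **Ky Fan's inequality.** -/
theorem exists_forall_nonneg_of_isCompact_of_convex [ContinuousAdd E] [ContinuousSMul ℝ E]
    [T2Space E] (hcomp : IsCompact K) (hK : Convex ℝ K) (hne : K.Nonempty)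
    (hcont : ∀ y ∈ K, ContinuousOn (F · y) K) (hconv : ∀ x ∈ K, ConvexOn ℝ K (F x))
    (hdiag : ∀ x ∈ K, 0 ≤ F x x) : ∃ x ∈ K, ∀ y ∈ K, 0 ≤ F x y := by
  classical
  have := hne.to_subtype
  obtain ⟨x, hx, hxF⟩ := hcomp.inter_iInter_nonempty (fun y : K ↦ {x | x ∈ K ∧ 0 ≤ F x y})
    (fun y ↦ hcomp.isClosed.isClosed_le continuousOn_const (hcont y y.2)) <| by
    intro u
    obtain ⟨y₀, hy₀⟩ := hne
    obtain ⟨x, hx, hxu⟩ := exists_forall_mem_finset_nonneg hK hcont hconv hdiag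
      (insert_nonempty y₀ (u.image Subtype.val))
      (by simp [Set.insert_subset_iff, hy₀])
    exact ⟨x, hx, Set.mem_iInter₂.2 fun y hy ↦
      ⟨hx, hxu y (mem_insert_of_mem (mem_image_of_mem _ hy))⟩⟩
  exact ⟨x, hx, fun y hy ↦ (Set.mem_iInter.1 hxF ⟨y, hy⟩).2⟩

end KyFan

/-! ### Weakly coercive convex functions -/

section LevelSets

theorem isClosed_levelSet {α : Type*} [TopologicalSpace α] {S : Set α} {η : α → ℝ}
    (hη : LowerSemicontinuousOn η S) (hS : IsClosed S) (ρ : ℝ) : IsClosed (levelSet S η ρ) := by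
  obtain ⟨v, hv, hSv⟩ := lowerSemicontinuousOn_iff_preimage_Iic.1 hη ρ
  have : levelSet S η ρ = S ∩ v := hSv
  exact this ▸ hS.inter hv

section Module

variable {E : Type*} [AddCommGroup E] [Module ℝ E] {S : Set E} {η : E → ℝ} {ρ : ℝ}

theorem forall_nonneg_of_forall_mem_levelSet_nonneg {f : E → ℝ} (hη : ConvexOn ℝ S η)
    (hf : ConvexOn ℝ S f) {x : E} (hx : x ∈ S) (hηx : η x < ρ) (hfx : f x = 0)
    (hlevel : ∀ y ∈ levelSet S η ρ, 0 ≤ f y) : ∀ y ∈ S, 0 ≤ f y := by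
  intro y hy
  rcases le_or_gt (η y) ρ with hle | hlt
  · exact hlevel y ⟨hy, hle⟩
  obtain ⟨t, ht₀, ht₁, ht⟩ : ∃ t : ℝ, 0 < t ∧ t ≤ 1 ∧ (1 - t) * η x + t * η y = ρ := by
    have : 0 < η y - η x := by linarith
    refine ⟨(ρ - η x) / (η y - η x), div_pos (by linarith) this,
      (div_le_one this).2 (by linarith), ?_⟩
    field_simp
    ring
  have hsub : 0 ≤ 1 - t := sub_nonneg.2 ht₁
  have hz : (1 - t) • x + t • y ∈ levelSet S η ρ :=
    ⟨hη.1 hx hy hsub ht₀.le (by ring), (hη.2 hx hy hsub ht₀.le (by ring)).trans ht.le⟩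
  have hft : 0 ≤ t * f y :=
    (hlevel _ hz).trans <| by simpa [hfx] using hf.2 hx hy hsub ht₀.le (by ring)
  exact nonneg_of_mul_nonneg_right hft ht₀

/-- Ky Fan's inequality without compactness: a solution on a compact level set that lies off the
boundary `η = ρ` is a solution everywhere, by convexity. -/
theorem exists_forall_nonneg_of_isCompact_levelSet [TopologicalSpace E] [ContinuousAdd E]
    [ContinuousSMul ℝ E] [T2Space E] {F : E → E → ℝ} (hη : ConvexOn ℝ S η)
    (hcomp : IsCompact (levelSet S η ρ)) (hne : (levelSet S η ρ).Nonempty)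
    (hcont : ∀ y ∈ S, ContinuousOn (F · y) S) (hconv : ∀ x ∈ S, ConvexOn ℝ S (F x))
    (hdiag : ∀ x ∈ S, F x x = 0)
    (hlt : ∀ x ∈ levelSet S η ρ, (∀ y ∈ levelSet S η ρ, 0 ≤ F x y) → η x < ρ) :
    ∃ x ∈ S, ∀ y ∈ S, 0 ≤ F x y := by
  have hsub : levelSet S η ρ ⊆ S := fun x hx ↦ hx.1
  have hK : Convex ℝ (levelSet S η ρ) := hη.convex_le ρ
  obtain ⟨x, hx, hxF⟩ := exists_forall_nonneg_of_isCompact_of_convex hcomp hK hne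
    (fun y hy ↦ (hcont y (hsub hy)).mono hsub) (fun x hx ↦ (hconv x (hsub hx)).subset hsub hK)
    fun x hx ↦ (hdiag x (hsub hx)).ge
  exact ⟨x, hx.1, forall_nonneg_of_forall_mem_levelSet_nonneg hη (hconv x hx.1) hx.1
    (hlt x hx hxF) (hdiag x hx.1) hxF⟩

end Module

variable {E : Type*} [NormedAddCommGroup E] [NormedSpace ℝ E] {S : Set E} {η : E → ℝ}

theorem dist_mul_le_of_convexOn (hη : ConvexOn ℝ S η) {x₀ x : E} {r δ R : ℝ} (hR : 0 < R)
    (hx₀ : x₀ ∈ S) (hηx₀ : η x₀ ≤ r) (hsphere : ∀ y ∈ S ∩ Metric.sphere x₀ R, r + δ ≤ η y)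
    (hx : x ∈ S) (hRx : R ≤ dist x x₀) : dist x x₀ * δ ≤ R * (η x - r) := by
  have hd : 0 < dist x x₀ := hR.trans_le hRx
  obtain ⟨t, ht₀, ht₁, htd⟩ : ∃ t : ℝ, 0 < t ∧ t ≤ 1 ∧ t * dist x x₀ = R :=
    ⟨R / dist x x₀, div_pos hR hd, (div_le_one hd).2 hRx, div_mul_cancel₀ R hd.ne'⟩
  have hsub : 0 ≤ 1 - t := sub_nonneg.2 ht₁
  have hmem : (1 - t) • x₀ + t • x ∈ S ∩ Metric.sphere x₀ R := by
    refine ⟨hη.1 hx₀ hx hsub ht₀.le (by ring), ?_⟩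
    rw [mem_sphere_iff_norm, show (1 - t) • x₀ + t • x - x₀ = t • (x - x₀) by module, norm_smul,
      Real.norm_of_nonneg ht₀.le, ← dist_eq_norm, htd]
  have hδ : δ ≤ t * (η x - r) := by
    have hle : r + δ ≤ (1 - t) * η x₀ + t * η x :=
      (hsphere _ hmem).trans (hη.2 hx₀ hx hsub ht₀.le (by ring))
    linarith [mul_le_mul_of_nonneg_left hηx₀ hsub]
  calc dist x x₀ * δ ≤ dist x x₀ * (t * (η x - r)) := by gcongr
    _ = R * (η x - r) := by rw [← htd]; ring

variable [ProperSpace E] (hη : ConvexOn ℝ S η) (hS : IsClosed S) (hlsc : LowerSemicontinuousOn η S)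
  (hw : WeaklyCoerciveOn S η)
include hη hS hlsc hw

theorem isBounded_levelSet (ρ : ℝ) : Bornology.IsBounded (levelSet S η ρ) := by
  obtain ⟨r, ⟨x₀, hx₀, hηx₀⟩, hbdd⟩ := hw
  obtain ⟨R, hR, hball⟩ := hbdd.subset_ball_lt 0 x₀
  obtain ⟨δ, hδ, hsphere⟩ : ∃ δ > 0, ∀ x ∈ S ∩ Metric.sphere x₀ R, r + δ ≤ η x := by
    rcases (S ∩ Metric.sphere x₀ R).eq_empty_or_nonempty with hempty | hne
    · exact ⟨1, one_pos, by simp [hempty]⟩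
    obtain ⟨y, ⟨hy, hyR⟩, hmin⟩ := (hlsc.mono Set.inter_subset_left).exists_isMinOn hne
      ((isCompact_sphere x₀ R).inter_left hS)
    have hry : r < η y := by
      by_contra! hle
      exact (Metric.mem_ball.1 (hball ⟨hy, hle⟩)).ne hyR
    exact ⟨η y - r, sub_pos.2 hry, fun x hx ↦ by rw [add_sub_cancel]; exact hmin hx⟩
  refine (Metric.isBounded_closedBall (x := x₀) (r := max R (R * (ρ - r) / δ))).subset ?_
  rintro x ⟨hx, hxρ⟩
  refine Metric.mem_closedBall.2 (le_max_iff.2 (or_iff_not_imp_left.2 fun hlt ↦ ?_))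
  rw [le_div_iff₀ hδ]
  exact (dist_mul_le_of_convexOn hη hR hx₀ hηx₀ hsphere hx (not_le.1 hlt).le).trans (by gcongr)

theorem isCompact_levelSet (ρ : ℝ) : IsCompact (levelSet S η ρ) :=
  Metric.isCompact_of_isClosed_isBounded (isClosed_levelSet hlsc hS ρ)
    (isBounded_levelSet hη hS hlsc hw ρ)

end LevelSets

/-! ### The penalized game -/

section ConvexOn

variable {E β : Type*} [AddCommGroup E] [Module ℝ E] [AddCommGroup β] [PartialOrder β]
  [Module ℝ β] {s : Set E}

theorem convexOn_sum [IsOrderedAddMonoid β] {ι : Type*} (t : Finset ι) {f : ι → E → β}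
    (hs : Convex ℝ s) (hf : ∀ i ∈ t, ConvexOn ℝ s (f i)) :
    ConvexOn ℝ s fun x ↦ ∑ i ∈ t, f i x :=
  ⟨hs, fun x hx y hy a b ha hb hab ↦ by
    simp only [smul_sum, ← sum_add_distrib]
    exact sum_le_sum fun i hi ↦ (hf i hi).2 hx hy ha hb hab⟩

theorem convexOn_comp_of_monotone {φ : β → ℝ} {f : E → β} (hφ : ConvexOn ℝ Set.univ φ)
    (hmono : Monotone φ) (hf : ConvexOn ℝ s f) : ConvexOn ℝ s fun x ↦ φ (f x) :=
  ⟨hf.1, fun _ hx _ hy _ _ ha hb hab ↦ (hmono (hf.2 hx hy ha hb hab)).trans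
    (hφ.2 (Set.mem_univ _) (Set.mem_univ _) ha hb hab)⟩

end ConvexOn

theorem mem_Icc_of_le_of_sum_eq {ι β : Type*} [Fintype ι] [AddCommGroup β] [PartialOrder β]
    [IsOrderedAddMonoid β] {a u : ι → β} {b : β} (ha : a ≤ u) (hu : ∑ i, u i = b) :
    u ∈ Set.Icc a fun i ↦ a i + (b - ∑ j, a j) := by
  refine ⟨ha, fun i ↦ sub_le_iff_le_add'.1 ?_⟩
  rw [← hu, ← sum_sub_distrib]
  exact single_le_sum (f := fun j ↦ u j - a j) (fun j _ ↦ sub_nonneg.2 (ha j)) (mem_univ i)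

namespace JointGame

variable {l m : ℕ} {G : JointGame l m}

theorem X_eq_pi : G.X = Set.univ.pi G.strat := by
  ext x
  simp [X]

theorem update_mem_X {x : G.Profile} (hx : x ∈ G.X) {i : Fin l}
    {y : EuclideanSpace ℝ (Fin (G.n i))} (hy : y ∈ G.strat i) : Function.update x i y ∈ G.X := by
  rw [X_eq_pi] at hx ⊢
  exact Set.update_mem_pi_iff_of_mem hx |>.2 fun _ ↦ hy

theorem Phi_self (x : G.Profile) : G.Phi x x = 0 := sub_self _

namespace BasicAssumptions

variable (hA : G.BasicAssumptions)
include hA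

theorem isClosed_X : IsClosed G.X :=
  X_eq_pi (G := G) ▸ isClosed_set_pi fun i _ ↦ hA.strat_closed i

theorem convex_X : Convex ℝ G.X :=
  X_eq_pi (G := G) ▸ convex_pi fun i _ ↦ hA.strat_convex i

theorem convexOn_Phi {x : G.Profile} (hx : x ∈ G.X) : ConvexOn ℝ G.X (G.Phi x) := by
  refine ⟨hA.convex_X, fun y hy z hz a b ha hb hab ↦ ?_⟩
  have hPsi : a * G.Psi x y + b * G.Psi x z ≤ G.Psi x (a • y + b • z) := by
    simp only [Psi, mul_sum, ← sum_add_distrib]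
    exact sum_le_sum fun i _ ↦ (hA.utility_concave i x hx).2 (hy i) (hz i) ha hb hab
  calc G.Psi x x - G.Psi x (a • y + b • z)
      ≤ (a + b) * G.Psi x x - (a * G.Psi x y + b * G.Psi x z) := by rw [hab, one_mul]; gcongr
    _ = a • G.Phi x y + b • G.Phi x z := by simp only [Phi, smul_eq_mul]; ring

theorem continuousOn_Phi {y : G.Profile} (hy : y ∈ G.X) : ContinuousOn (G.Phi · y) G.X := by
  unfold Phi Psi
  simp only [Function.update_eq_self]
  refine .sub (continuousOn_finsetSum _ fun i _ ↦ hA.utility_continuous i)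
    (continuousOn_finsetSum _ fun i _ ↦ ?_)
  exact (hA.utility_continuous i).comp (continuous_id.update i continuous_const).continuousOn
    fun x hx ↦ update_mem_X hx (hy i)

theorem continuous_h : Continuous fun (x : G.Profile) i ↦ G.h i (x i) :=
  continuous_pi fun i ↦ continuous_pi fun j ↦
    (hA.constraint_convex i j).locallyLipschitz.continuous.comp (continuous_apply i)

theorem convexOn_h (i : Fin l) : ConvexOn ℝ Set.univ fun x : G.Profile ↦ G.h i (x i) :=
  ⟨convex_univ, fun _ _ _ _ _ _ ha hb hab j ↦
    (hA.constraint_convex i j).2 (Set.mem_univ _) (Set.mem_univ _) ha hb hab⟩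

theorem isClosed_D : IsClosed G.D :=
  hA.isClosed_X.inter <| isClosed_le
    (continuous_finsetSum _ fun i _ ↦ (continuous_apply i).comp hA.continuous_h) continuous_const

theorem convex_D : Convex ℝ G.D := by
  have hY := (convexOn_sum univ convex_univ fun i _ ↦ hA.convexOn_h i).convex_le G.b
  simp only [Set.mem_univ, true_and] at hY
  exact hA.convex_X.inter hY

theorem exists_pos_forall_Phi_le {K : Set G.Profile} (hK : IsCompact K) (hKX : K ⊆ G.X)
    {y : G.Profile} (hy : y ∈ G.X) : ∃ M, 0 < M ∧ ∀ x ∈ K, G.Phi x y ≤ M := by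
  obtain ⟨M, hM⟩ := hK.bddAbove_image ((hA.continuousOn_Phi hy).mono hKX)
  exact ⟨max M 1, by positivity, fun x hx ↦ (hM ⟨x, hx, rfl⟩).trans (le_max_left M 1)⟩

end BasicAssumptions

end JointGame

/-- A penalty generator that need not be differentiable; its role is to detect infeasibility, so
`φ v = 0` exactly when `v ≤ 0`. -/
structure IsConvexPenalty {m : ℕ} (φ : (Fin m → ℝ) → ℝ) : Prop where
  convex : ConvexOn ℝ Set.univ φ
  isotone : Monotone φ
  eq_zero : ∀ v, v ≤ 0 → φ v = 0
  pos : ∀ v, ¬v ≤ 0 → 0 < φ v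

theorem IsPenaltyGenerator.isConvexPenalty {m : ℕ} {φ : (Fin m → ℝ) → ℝ}
    (hφ : IsPenaltyGenerator φ) : IsConvexPenalty φ :=
  ⟨hφ.convex, hφ.isotone, hφ.eq_zero, hφ.pos⟩

namespace IsConvexPenalty

variable {m : ℕ} {φ : (Fin m → ℝ) → ℝ} (hφ : IsConvexPenalty φ)
include hφ

theorem nonneg (v : Fin m → ℝ) : 0 ≤ φ v :=
  (em (v ≤ 0)).elim (fun hv ↦ (hφ.eq_zero v hv).ge) fun hv ↦ (hφ.pos v hv).le

theorem eq_zero_iff {v : Fin m → ℝ} : φ v = 0 ↔ v ≤ 0 :=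
  ⟨fun hv ↦ by_contra fun hlt ↦ (hφ.pos v hlt).ne' hv, hφ.eq_zero v⟩

end IsConvexPenalty

namespace JointGame

variable {l m : ℕ} {G : JointGame l m} {U₀ : Set (Fin l → Fin m → ℝ)} {φ : (Fin m → ℝ) → ℝ}
  {w : G.Profile × (Fin l → Fin m → ℝ)}

section Penalty

theorem P_nonneg (hφ : IsConvexPenalty φ) (w : G.Profile × (Fin l → Fin m → ℝ)) : 0 ≤ G.P φ w :=
  sum_nonneg fun _ _ ↦ hφ.nonneg _

theorem P_eq_zero_iff (hφ : IsConvexPenalty φ) : G.P φ w = 0 ↔ ∀ i, G.h i (w.1 i) ≤ w.2 i := by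
  simp only [P, sum_eq_zero_iff_of_nonneg fun _ _ ↦ hφ.nonneg _, mem_univ, true_imp_iff,
    hφ.eq_zero_iff, sub_nonpos]

theorem mem_D_of_P_eq_zero (hφ : IsConvexPenalty φ) (hw : w ∈ G.X ×ˢ G.U U₀)
    (hP : G.P φ w = 0) : w.1 ∈ G.D :=
  ⟨hw.1, (sum_le_sum fun i _ ↦ (P_eq_zero_iff hφ).1 hP i).trans hw.2.2.le⟩

theorem exists_P_eq_zero (hU : G.AdmissibleRestriction U₀) (hφ : IsConvexPenalty φ)
    {x : G.Profile} (hx : x ∈ G.D) : ∃ u ∈ G.U U₀, G.P φ (x, u) = 0 := by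
  obtain ⟨u, hu, hxu⟩ := hU.covers x hx
  exact ⟨u, hu, (P_eq_zero_iff hφ).2 hxu⟩

theorem continuous_P (hA : G.BasicAssumptions) (hφ : IsConvexPenalty φ) : Continuous (G.P φ) :=
  continuous_finsetSum _ fun i _ ↦ hφ.convex.locallyLipschitz.continuous.comp
    (((continuous_apply i).comp (hA.continuous_h.comp continuous_fst)).sub
      ((continuous_apply i).comp continuous_snd))

theorem convexOn_P (hA : G.BasicAssumptions) (hφ : IsConvexPenalty φ) :
    ConvexOn ℝ Set.univ (G.P φ) :=
  convexOn_sum univ convex_univ fun i _ ↦ convexOn_comp_of_monotone hφ.convex hφ.isotone <|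
    ((hA.convexOn_h i).comp_linearMap (LinearMap.fst ℝ _ _)).sub <|
      (LinearMap.proj i ∘ₗ LinearMap.snd ℝ G.Profile (Fin l → Fin m → ℝ)).concaveOn convex_univ

theorem isBounded_levelSet_P_zero (hA : G.BasicAssumptions) (hφ : IsConvexPenalty φ)
    {K : Set G.Profile} (hK : IsCompact K) :
    Bornology.IsBounded (levelSet (K ×ˢ G.U U₀) (G.P φ) 0) := by
  obtain ⟨a, ha⟩ := (hK.image hA.continuous_h).isBounded.bddBelow
  refine (hK.isBounded.prod (isCompact_Icc (a := a)).isBounded).subset fun w hw ↦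
    ⟨hw.1.1, mem_Icc_of_le_of_sum_eq ((ha ⟨w.1, hw.1.1, rfl⟩).trans ?_) hw.1.2.2⟩
  exact (P_eq_zero_iff hφ).1 (hw.2.antisymm (P_nonneg hφ w))

end Penalty

section PenalizedPhi

/-- The bifunction `Φ(x, x') + t [P(w') - P(w)]`, for `w = (x, u)` and `w' = (x', u')`, of the
penalized problem with parameter `t`. -/
noncomputable def penalizedPhi (G : JointGame l m) (φ : (Fin m → ℝ) → ℝ) (t : ℝ)
    (w w' : G.Profile × (Fin l → Fin m → ℝ)) : ℝ :=
  G.Phi w.1 w'.1 + t * (G.P φ w' - G.P φ w)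

theorem penalizedPhi_self (t : ℝ) (w : G.Profile × (Fin l → Fin m → ℝ)) :
    G.penalizedPhi φ t w w = 0 := by
  simp [penalizedPhi, Phi_self]

theorem penalizedPhi_nonneg_iff {t : ℝ} {w' : G.Profile × (Fin l → Fin m → ℝ)}
    (hw' : G.P φ w' = 0) : 0 ≤ G.penalizedPhi φ t w w' ↔ t * G.P φ w ≤ G.Phi w.1 w'.1 := by
  rw [penalizedPhi, hw', zero_sub, mul_neg, ← sub_eq_add_neg, sub_nonneg]

theorem convexOn_penalizedPhi (hA : G.BasicAssumptions) (hU : G.AdmissibleRestriction U₀)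
    (hφ : IsConvexPenalty φ) {t : ℝ} (ht : 0 ≤ t) (hw : w ∈ G.X ×ˢ G.U U₀) :
    ConvexOn ℝ (G.X ×ˢ G.U U₀) (G.penalizedPhi φ t w) := by
  have hS : Convex ℝ (G.X ×ˢ G.U U₀) := hA.convex_X.prod hU.convex
  have hPhi : ConvexOn ℝ (G.X ×ˢ G.U U₀) fun w' ↦ G.Phi w.1 w'.1 :=
    ((hA.convexOn_Phi hw.1).comp_linearMap (LinearMap.fst ℝ _ _)).subset (fun _ h ↦ h.1) hS
  exact hPhi.add ((((convexOn_P hA hφ).subset (Set.subset_univ _) hS).sub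
    (concaveOn_const _ hS)).smul ht)

theorem continuousOn_penalizedPhi (hA : G.BasicAssumptions) (hφ : IsConvexPenalty φ) (t : ℝ)
    (hw : w ∈ G.X ×ˢ G.U U₀) :
    ContinuousOn (G.penalizedPhi φ t · w) (G.X ×ˢ G.U U₀) :=
  ((hA.continuousOn_Phi hw.1).comp continuousOn_fst fun _ h ↦ h.1).add
    (continuousOn_const.mul (continuousOn_const.sub (continuous_P hA hφ).continuousOn))

end PenalizedPhi

section Coercivity

variable {μ : G.Profile → ℝ} {r : ℝ}

theorem Coercivity.mem_levelSet_of_forall_nonneg (hC : G.Coercivity μ r) {x : G.Profile}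
    (hx : x ∈ G.X) (hPhi : ∀ y ∈ G.D, μ y ≤ μ x → 0 ≤ G.Phi x y) : x ∈ levelSet G.X μ r := by
  by_contra hxr
  obtain ⟨y, hy, hyx, hneg⟩ := hC.descent x ⟨hx, hxr⟩
  exact (hPhi y hy hyx).not_gt hneg

theorem Coercivity.isCompact_levelSet (hC : G.Coercivity μ r) (hA : G.BasicAssumptions) (ρ : ℝ) :
    IsCompact (levelSet G.X μ ρ) :=
  _root_.isCompact_levelSet hC.convex hA.isClosed_X hC.lsc hC.weaklyCoercive ρ

theorem Coercivity.exists_isNormalizedEquilibrium (hC : G.Coercivity μ r)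
    (hA : G.BasicAssumptions) : ∃ x, G.IsNormalizedEquilibrium x := by
  obtain ⟨z, hz⟩ := hA.feasible_nonempty
  have hDX : G.D ⊆ G.X := Set.inter_subset_left
  have hcomp : IsCompact (levelSet G.D μ (max (μ z) (r + 1))) :=
    (hC.isCompact_levelSet hA _).of_isClosed_subset
      (isClosed_levelSet (hC.lsc.mono hDX) hA.isClosed_D _) fun x hx ↦ ⟨hDX hx.1, hx.2⟩
  refine exists_forall_nonneg_of_isCompact_levelSet (hC.convex.subset hDX hA.convex_D) hcomp
    ⟨z, hz, le_max_left _ _⟩ (fun y hy ↦ (hA.continuousOn_Phi (hDX hy)).mono hDX)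
    (fun x hx ↦ (hA.convexOn_Phi (hDX hx)).subset hDX hA.convex_D) (fun x _ ↦ Phi_self x) ?_
  intro x hx hxPhi
  have hxr := hC.mem_levelSet_of_forall_nonneg (hDX hx.1) fun y hy hyx ↦
    hxPhi y ⟨hy, hyx.trans hx.2⟩
  exact lt_max_of_lt_right (hxr.2.trans_lt (lt_add_one r))

theorem weaklyCoerciveOn_eta (hA : G.BasicAssumptions) (hU : G.AdmissibleRestriction U₀)
    (hφ : IsConvexPenalty φ) (hC : G.Coercivity μ r) :
    WeaklyCoerciveOn (G.X ×ˢ G.U U₀) (G.eta φ μ) := by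
  obtain ⟨z, hz⟩ := hA.feasible_nonempty
  obtain ⟨u, hu, hPu⟩ := exists_P_eq_zero hU hφ hz
  let ρ := max (μ z) 0
  have hK : IsCompact (levelSet G.X μ ρ) := hC.isCompact_levelSet hA ρ
  have hP : WeaklyCoerciveOn (levelSet G.X μ ρ ×ˢ G.U U₀) (G.P φ) :=
    ⟨0, ⟨(z, u), ⟨⟨hz.1, le_max_left _ _⟩, hu⟩, hPu.le⟩, isBounded_levelSet_P_zero hA hφ hK⟩
  refine ⟨ρ, ⟨(z, u), ⟨hz.1, hu⟩, max_le_max_left _ hPu.le⟩, ?_⟩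
  refine (isBounded_levelSet ((convexOn_P hA hφ).subset (Set.subset_univ _)
    ((hC.convex.convex_le ρ).prod hU.convex)) (hK.isClosed.prod hU.closed)
    (continuous_P hA hφ).continuousOn.lowerSemicontinuousOn hP ρ).subset fun w hw ↦ ?_
  exact ⟨⟨⟨hw.1.1, (le_max_left _ _).trans hw.2⟩, hw.1.2⟩, (le_max_right _ _).trans hw.2⟩

theorem convexOn_eta (hA : G.BasicAssumptions) (hU : G.AdmissibleRestriction U₀)
    (hφ : IsConvexPenalty φ) (hC : G.Coercivity μ r) :
    ConvexOn ℝ (G.X ×ˢ G.U U₀) (G.eta φ μ) := by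
  have hS : Convex ℝ (G.X ×ˢ G.U U₀) := hA.convex_X.prod hU.convex
  exact ((hC.convex.comp_linearMap (LinearMap.fst ℝ _ _)).subset (fun _ h ↦ h.1) hS).sup
    ((convexOn_P hA hφ).subset (Set.subset_univ _) hS)

theorem isCompact_levelSet_eta (hA : G.BasicAssumptions) (hU : G.AdmissibleRestriction U₀)
    (hφ : IsConvexPenalty φ) (hC : G.Coercivity μ r) (ρ : ℝ) :
    IsCompact (levelSet (G.X ×ˢ G.U U₀) (G.eta φ μ) ρ) :=
  isCompact_levelSet (convexOn_eta hA hU hφ hC) (hA.isClosed_X.prod hU.closed)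
    ((hC.lsc.comp continuousOn_fst fun _ h ↦ h.1).sup
      (continuous_P hA hφ).continuousOn.lowerSemicontinuousOn)
    (weaklyCoerciveOn_eta hA hU hφ hC) ρ

end Coercivity

section PenaltySolution

variable {μ : G.Profile → ℝ} {r : ℝ}

theorem exists_isPenaltySolution (hA : G.BasicAssumptions) (hU : G.AdmissibleRestriction U₀)
    (hφ : IsConvexPenalty φ) (hC : G.Coercivity μ r) {z : G.Profile} (hz : z ∈ G.D) {ρ t : ℝ}
    (hzρ : μ z ≤ ρ) (hρ : 0 < ρ) (hrρ : r < ρ) (ht : 0 < t)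
    (hlarge : ∀ x ∈ levelSet G.X μ r, G.Phi x z < t * ρ) :
    ∃ w, G.IsPenaltySolution U₀ φ t w := by
  have hlift : ∀ y ∈ G.D, μ y ≤ ρ →
      ∃ u, (y, u) ∈ levelSet (G.X ×ˢ G.U U₀) (G.eta φ μ) ρ ∧ G.P φ (y, u) = 0 := by
    intro y hy hyρ
    obtain ⟨u, hu, hPu⟩ := exists_P_eq_zero hU hφ hy
    exact ⟨u, ⟨⟨hy.1, hu⟩, max_le hyρ (hPu.le.trans hρ.le)⟩, hPu⟩
  obtain ⟨u, hu, -⟩ := hlift z hz hzρ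
  refine exists_forall_nonneg_of_isCompact_levelSet (convexOn_eta hA hU hφ hC)
    (isCompact_levelSet_eta hA hU hφ hC ρ) ⟨_, hu⟩
    (fun w hw ↦ continuousOn_penalizedPhi hA hφ t hw)
    (fun w hw ↦ convexOn_penalizedPhi hA hU hφ ht.le hw) (fun w _ ↦ penalizedPhi_self t w) ?_
  intro w hw hwF
  have hPhi : ∀ y ∈ G.D, μ y ≤ ρ → t * G.P φ w ≤ G.Phi w.1 y := by
    intro y hy hyρ
    obtain ⟨u, hu, hPu⟩ := hlift y hy hyρ
    exact (penalizedPhi_nonneg_iff hPu).1 (hwF _ hu)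
  have hwr : w.1 ∈ levelSet G.X μ r := hC.mem_levelSet_of_forall_nonneg hw.1.1 fun y hy hyw ↦
    (mul_nonneg ht.le (P_nonneg hφ w)).trans
      (hPhi y hy (hyw.trans ((le_max_left _ _).trans hw.2)))
  exact max_lt (hwr.2.trans_lt hrρ)
    (lt_of_mul_lt_mul_left ((hPhi z hz hzρ).trans_lt (hlarge _ hwr)) ht.le)

namespace IsPenaltySolution

variable {t : ℝ} (hw : G.IsPenaltySolution U₀ φ t w)
include hw

theorem mul_P_le (hU : G.AdmissibleRestriction U₀) (hφ : IsConvexPenalty φ) {y : G.Profile}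
    (hy : y ∈ G.D) : t * G.P φ w ≤ G.Phi w.1 y := by
  obtain ⟨u, hu, hPu⟩ := exists_P_eq_zero hU hφ hy
  exact (penalizedPhi_nonneg_iff hPu).1 (hw.2 (y, u) ⟨hy.1, hu⟩)

theorem Phi_nonneg (hU : G.AdmissibleRestriction U₀) (hφ : IsConvexPenalty φ) (ht : 0 ≤ t)
    {y : G.Profile} (hy : y ∈ G.D) : 0 ≤ G.Phi w.1 y :=
  (mul_nonneg ht (P_nonneg hφ w)).trans (hw.mul_P_le hU hφ hy)

theorem fst_mem_levelSet (hU : G.AdmissibleRestriction U₀) (hφ : IsConvexPenalty φ)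
    (hC : G.Coercivity μ r) (ht : 0 ≤ t) : w.1 ∈ levelSet G.X μ r :=
  hC.mem_levelSet_of_forall_nonneg hw.1.1 fun _ hy _ ↦ hw.Phi_nonneg hU hφ ht hy

end IsPenaltySolution

theorem eventually_fst_mem_levelSet (hU : G.AdmissibleRestriction U₀) (hφ : IsConvexPenalty φ)
    (hC : G.Coercivity μ r) {ι : Type*} {L : Filter ι} {τ : ι → ℝ} (hτ : Tendsto τ L atTop)
    {v : ι → G.Profile × (Fin l → Fin m → ℝ)}
    (hv : ∀ᶠ k in L, G.IsPenaltySolution U₀ φ (τ k) (v k)) :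
    ∀ᶠ k in L, (v k).1 ∈ levelSet G.X μ r := by
  filter_upwards [hτ.eventually_ge_atTop 0, hv] with k hk hvk
  exact hvk.fst_mem_levelSet hU hφ hC hk

variable (hA : G.BasicAssumptions) (hU : G.AdmissibleRestriction U₀) (hφ : IsConvexPenalty φ)
  (hC : G.Coercivity μ r)
include hA hU hφ hC

theorem exists_forall_isPenaltySolution_mul_P_le : ∃ M, 0 < M ∧
    ∀ t, 0 ≤ t → ∀ w, G.IsPenaltySolution U₀ φ t w → t * G.P φ w ≤ M := by
  obtain ⟨z, hz⟩ := hA.feasible_nonempty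
  obtain ⟨M, hM, hPhi⟩ := hA.exists_pos_forall_Phi_le (hC.isCompact_levelSet hA r)
    (fun _ hx ↦ hx.1) hz.1
  exact ⟨M, hM, fun t ht w hw ↦ (hw.mul_P_le hU hφ hz).trans
    (hPhi _ (hw.fst_mem_levelSet hU hφ hC ht))⟩

theorem eventually_exists_isPenaltySolution :
    ∀ᶠ t in atTop, ∃ w, G.IsPenaltySolution U₀ φ t w := by
  obtain ⟨z, hz⟩ := hA.feasible_nonempty
  obtain ⟨M, -, hM⟩ := hA.exists_pos_forall_Phi_le (hC.isCompact_levelSet hA r)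
    (fun _ hx ↦ hx.1) hz.1
  let ρ := max (μ z) (max 0 r + 1)
  have hρ : max 0 r < ρ := (lt_add_one _).trans_le (le_max_right _ _)
  have hρ₀ : 0 < ρ := (le_max_left 0 r).trans_lt hρ
  filter_upwards [eventually_gt_atTop 0, eventually_gt_atTop (M / ρ)] with t ht htM
  exact exists_isPenaltySolution hA hU hφ hC hz (le_max_left _ _) hρ₀
    ((le_max_right 0 r).trans_lt hρ) ht fun x hx ↦ (hM x hx).trans_lt ((div_lt_iff₀ hρ₀).1 htM)

theorem eventually_forall_isPenaltySolution_mem_levelSet (hr : 0 < r) :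
    ∀ᶠ t in atTop, ∀ w, G.IsPenaltySolution U₀ φ t w →
      w ∈ levelSet (G.X ×ˢ G.U U₀) (G.eta φ μ) r := by
  obtain ⟨M, -, hM⟩ := exists_forall_isPenaltySolution_mul_P_le hA hU hφ hC
  filter_upwards [eventually_gt_atTop 0, eventually_gt_atTop (M / r)] with t ht htM w hw
  have hP : t * G.P φ w ≤ t * r := (hM t ht.le w hw).trans ((div_lt_iff₀ hr).1 htM).le
  exact ⟨hw.1, max_le (hw.fst_mem_levelSet hU hφ hC ht.le).2 (le_of_mul_le_mul_left hP ht)⟩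

section Limits

variable {ι : Type*} {L : Filter ι} {τ : ι → ℝ} (hτ : Tendsto τ L atTop)
  {v : ι → G.Profile × (Fin l → Fin m → ℝ)}
  (hv : ∀ᶠ k in L, G.IsPenaltySolution U₀ φ (τ k) (v k))
include hτ hv

theorem tendsto_P_isPenaltySolution : Tendsto (fun k ↦ G.P φ (v k)) L (𝓝 0) := by
  obtain ⟨M, -, hM⟩ := exists_forall_isPenaltySolution_mul_P_le hA hU hφ hC
  refine squeeze_zero' (.of_forall fun k ↦ P_nonneg hφ (v k)) ?_
    (tendsto_const_nhds (x := M) |>.div_atTop hτ)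
  filter_upwards [hτ.eventually_gt_atTop 0, hv] with k hk hvk
  exact (le_div_iff₀' hk).2 (hM _ hk.le _ hvk)

theorem exists_mapClusterPt_isPenaltySolution [NeBot L] : ∃ w, MapClusterPt w L v := by
  have hP := (tendsto_P_isPenaltySolution hA hU hφ hC hτ hv).eventually_le_const one_pos
  have hmem : ∀ᶠ k in L, v k ∈ levelSet (G.X ×ˢ G.U U₀) (G.eta φ μ) (max r 1) := by
    filter_upwards [hv, eventually_fst_mem_levelSet hU hφ hC hτ hv, hP] with k hk hkr hkP
    exact ⟨hk.1, max_le_max hkr.2 hkP⟩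
  obtain ⟨w, -, hw⟩ := (isCompact_levelSet_eta hA hU hφ hC (max r 1)).exists_mapClusterPt
    (le_principal_iff.2 hmem)
  exact ⟨w, hw⟩

theorem isNormalizedEquilibrium_of_tendsto [NeBot L] (hw : Tendsto v L (𝓝 w)) :
    w ∈ (levelSet G.X μ r ∩ G.D) ×ˢ G.U U₀ ∧ G.IsNormalizedEquilibrium w.1 := by
  have hS : IsClosed (G.X ×ˢ G.U U₀) := hA.isClosed_X.prod hU.closed
  have hr : w.1 ∈ levelSet G.X μ r := (hC.isCompact_levelSet hA r).isClosed.mem_of_tendsto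
    hw.fst_nhds (eventually_fst_mem_levelSet hU hφ hC hτ hv)
  have hwS : w ∈ G.X ×ˢ G.U U₀ := hS.mem_of_tendsto hw (hv.mono fun _ hk ↦ hk.1)
  have hD : w.1 ∈ G.D := mem_D_of_P_eq_zero hφ hwS <|
    tendsto_nhds_unique (((continuous_P hA hφ).tendsto w).comp hw)
      (tendsto_P_isPenaltySolution hA hU hφ hC hτ hv)
  refine ⟨⟨⟨hr, hD⟩, hwS.2⟩, hD, fun y hy ↦ ?_⟩
  refine ge_of_tendsto ((hA.continuousOn_Phi hy.1 w.1 hwS.1).tendsto.comp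
    (tendsto_nhdsWithin_iff.2 ⟨hw.fst_nhds, hv.mono fun k hk ↦ hk.1.1⟩)) ?_
  filter_upwards [hτ.eventually_ge_atTop 0, hv] with k hk hvk
  exact hvk.Phi_nonneg hU hφ hk hy

theorem isNormalizedEquilibrium_of_mapClusterPt (hw : MapClusterPt w L v) :
    w ∈ (levelSet G.X μ r ∩ G.D) ×ˢ G.U U₀ ∧ G.IsNormalizedEquilibrium w.1 := by
  obtain ⟨𝒰, h𝒰, hw𝒰⟩ := mapClusterPt_iff_ultrafilter.1 hw
  exact isNormalizedEquilibrium_of_tendsto hA hU hφ hC (hτ.mono_left h𝒰) (hv.filter_mono h𝒰) hw𝒰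

end Limits

end PenaltySolution

end JointGame

open JointGame in
theorem theorem4p2_general {l m : ℕ} (G : JointGame l m) (hA : G.BasicAssumptions)
    (U₀ : Set (Fin l → Fin m → ℝ)) (hU : G.AdmissibleRestriction U₀)
    (φ : (Fin m → ℝ) → ℝ) (hφ : IsConvexPenalty φ)
    (μ : G.Profile → ℝ) (r : ℝ) (hC : G.Coercivity μ r)
    {ι : Type*} (L : Filter ι) [L.NeBot] (τ : ι → ℝ) (hτ : Filter.Tendsto τ L Filter.atTop) :
    (∃ x, G.IsNormalizedEquilibrium x) ∧
    WeaklyCoerciveOn (G.X ×ˢ G.U U₀) (G.eta φ μ) ∧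
    (∃ τ' : ℝ, 0 < τ' ∧ ∀ t, τ' < t →
      (∃ w, G.IsPenaltySolution U₀ φ t w) ∧
      (0 < r → ∀ w, G.IsPenaltySolution U₀ φ t w →
        w ∈ levelSet (G.X ×ˢ G.U U₀) (G.eta φ μ) r)) ∧
    (∀ w : ι → G.Profile × (Fin l → Fin m → ℝ),
      (∀ᶠ k in L, G.IsPenaltySolution U₀ φ (τ k) (w k)) →
        (∃ w', MapClusterPt w' L w) ∧
        ∀ w', MapClusterPt w' L w →
          w' ∈ (levelSet G.X μ r ∩ G.D) ×ˢ G.U U₀ ∧ G.IsNormalizedEquilibrium w'.1) := by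
  refine ⟨hC.exists_isNormalizedEquilibrium hA, weaklyCoerciveOn_eta hA hU hφ hC, ?_, fun w hw ↦
    ⟨exists_mapClusterPt_isPenaltySolution hA hU hφ hC hτ hw, fun w' hw' ↦
      isNormalizedEquilibrium_of_mapClusterPt hA hU hφ hC hτ hw hw'⟩⟩
  have hlarge := (eventually_exists_isPenaltySolution hA hU hφ hC).and <|
    eventually_imp_distrib_left.2 (eventually_forall_isPenaltySolution_mem_levelSet hA hU hφ hC)
  obtain ⟨T, hT⟩ := eventually_atTop.1 hlarge
  exact ⟨max T 1, lt_max_of_lt_right one_pos, fun t ht ↦ hT t (le_of_max_le_left ht.le)⟩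

theorem theorem4p2 {l m : ℕ} (G : JointGame l m) (hA : G.BasicAssumptions)
    (U₀ : Set (Fin l → Fin m → ℝ)) (hU : G.AdmissibleRestriction U₀)
    (φ : (Fin m → ℝ) → ℝ) (hφ : IsPenaltyGenerator φ)
    (μ : G.Profile → ℝ) (r : ℝ) (hC : G.Coercivity μ r)
    (τ : ℕ → ℝ) (hτ_pos : ∀ k, 0 < τ k) (hτ : Filter.Tendsto τ Filter.atTop Filter.atTop) :
    (∃ x, G.IsNormalizedEquilibrium x) ∧
    WeaklyCoerciveOn (G.X ×ˢ G.U U₀) (G.eta φ μ) ∧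
    (∃ τ' : ℝ, 0 < τ' ∧ ∀ t, τ' < t →
      (∃ w, G.IsPenaltySolution U₀ φ t w) ∧
      (0 < r → ∀ w, G.IsPenaltySolution U₀ φ t w →
        w ∈ levelSet (G.X ×ˢ G.U U₀) (G.eta φ μ) r)) ∧
    (∀ w : ℕ → G.Profile × (Fin l → Fin m → ℝ),
      (∀ k, G.IsPenaltySolution U₀ φ (τ k) (w k)) →
        (∃ w', MapClusterPt w' Filter.atTop w) ∧
        ∀ w', MapClusterPt w' Filter.atTop w →
          w' ∈ (levelSet G.X μ r ∩ G.D) ×ˢ G.U U₀ ∧ G.IsNormalizedEquilibrium w'.1) := by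
  obtain ⟨hi, hcoercive, hii, hiii⟩ :=
    theorem4p2_general G hA U₀ hU φ hφ.isConvexPenalty μ r hC Filter.atTop τ hτ
  exact ⟨hi, hcoercive, hii, fun w hw ↦ hiii w (.of_forall hw)⟩
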